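/- All rings are commutative with unity. Let $R \to S$ be a ring homomorphism. For $f \in S$, the \emph{content} $c(f)$ is the intersection of all ideals $I$ of $R$ with $f \in IS$; the algebra $R \to S$ is \emph{Ohm-Rush} if $f \in c(f)S$ for all $f \in S$. An Ohm-Rush algebra $R \to S$ is called - \emph{weak content} if $\sqrt{c(fg)} = \sqrt{c(f)c(g)}$ for all $f, g \in S$; - \emph{semicontent} if it is faithfully flat and, for every multiplicative subset $W \subseteq R$ and all $f, g \in S$ with $c(f) \cap W \neq \emptyset$, one has $c(fg)_W = c(g)_W$ as ideals of $R_W$; - \emph{McCoy} if whenever $f, g \in S$ with $fg = 0$ and $g \neq 0$, there is a nonzero $r \in R$ with $r\,c(f) = 0$; - \emph{residually McCoy for} a set $\mathcal{I}$ of ideals of $R$ if for every $I \in \mathcal{I}$ the algebra $R/I \to S/IS$ is (Ohm-Rush and) McCoy; and \emph{residually McCoy} if this holds for the set of all ideals of $R$. \textbf{Theorem.} Let $R \to S$ be a faithfully flat Ohm-Rush algebra, and assume that $R$ is Noetherian. Then the following are equivalent: 1. $S$ is a weak content $R$-algebra. 2. $S$ is a semicontent $R$-algebra. 3. $R \to S$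 is residually McCoy. 4. $R \to S$ is residually McCoy for radical ideals. 5. $R \to S$ is residually McCoy for prime ideals. -/

import Mathlib

namespace OhmRush

/-- The content `c(f)` of `f ∈ S`: the intersection of all ideals `I` of `R` with `f ∈ IS`. -/
def content (R : Type*) {S : Type*} [CommRing R] [CommRing S] [Algebra R S] (f : S) : Ideal R :=
  sInf {I : Ideal R | f ∈ I.map (algebraMap R S)}

/-- `R → S` is Ohm-Rush if `f ∈ c(f)S` for every `f ∈ S`. -/
def IsOhmRush (R S : Type*) [CommRing R] [CommRing S] [Algebra R S] : Prop :=
  ∀ f : S, f ∈ (content R f).map (algebraMap R S)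

/-- Weak content algebra: Ohm-Rush, and `c(fg)` and `c(f)c(g)` always have the same radical. -/
structure IsWeakContent (R S : Type*) [CommRing R] [CommRing S] [Algebra R S] : Prop where
  isOhmRush : IsOhmRush R S
  radical_eq : ∀ f g : S,
    (content R (f * g)).radical = (content R f * content R g).radical

/-- Semicontent algebra: faithfully flat, Ohm-Rush, and for every multiplicative set `W` of `R`
and all `f, g ∈ S` such that `c(f)` meets `W`, one has `c(fg)_W = c(g)_W` in `R_W`. -/
structure IsSemicontent (R S : Type*) [CommRing R] [CommRing S] [Algebra R S] : Prop where
  faithfullyFlat : Module.FaithfullyFlat R S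
  isOhmRush : IsOhmRush R S
  map_content_eq : ∀ (W : Submonoid R) (f g : S), (∃ w ∈ W, w ∈ content R f) →
    (content R (f * g)).map (algebraMap R (Localization W)) =
      (content R g).map (algebraMap R (Localization W))

/-- McCoy algebra: Ohm-Rush, and whenever `fg = 0` with `g ≠ 0`, some nonzero `r ∈ R`
satisfies `r c(f) = 0`. -/
structure IsMcCoy (R S : Type*) [CommRing R] [CommRing S] [Algebra R S] : Prop where
  isOhmRush : IsOhmRush R S
  exists_mul_content_eq_zero : ∀ f g : S, f * g = 0 → g ≠ 0 →
    ∃ r : R, r ≠ 0 ∧ ∀ a ∈ content R f, r * a = 0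

/-- `R → S` is residually McCoy for a set `𝓘` of ideals of `R` if it is Ohm-Rush and
`R/I → S/IS` is McCoy for all `I ∈ 𝓘`. -/
structure IsResiduallyMcCoyFor (R S : Type*) [CommRing R] [CommRing S] [Algebra R S]
    (𝓘 : Set (Ideal R)) : Prop where
  isOhmRush : IsOhmRush R S
  isMcCoy_quotient : ∀ I ∈ 𝓘, IsMcCoy (R ⧸ I) (S ⧸ I.map (algebraMap R S))

/-- Residually McCoy: residually McCoy for the set of all ideals. -/
def IsResiduallyMcCoy (R S : Type*) [CommRing R] [CommRing S] [Algebra R S] : Prop :=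
  IsResiduallyMcCoyFor R S Set.univ

end OhmRush

namespace OhmRush

section

variable {R S : Type*} [CommRing R] [CommRing S] [Algebra R S]

/-! Every condition is equivalent to: primes of `R` extend to primes of `S`. For an Ohm-Rush
algebra, `f ∈ IS` iff `c(f) ≤ I`, so each condition, tested at a prime, gives this one. The
substantial converse is `IsOhmRush.exists_forall_mul_mem`: if `fg ∈ IS` and `g ∉ IS`, some `r ∉ I`
multiplies `c(f)` into `I`. An associated-prime argument replaces `g` by an `h` whose annihilator
modulo `IS` contracts to a prime `p`; flatness gives `p c(h) ≤ I`. Primality of `pS` then forces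
`c(f) ≤ p`, and a suitable `r ∈ c(h)` works. -/

lemma content_le_of_mem_map {f : S} {I : Ideal R} (h : f ∈ I.map (algebraMap R S)) :
    content R f ≤ I :=
  sInf_le h

lemma IsOhmRush.mem_map_iff (hS : IsOhmRush R S) {f : S} {I : Ideal R} :
    f ∈ I.map (algebraMap R S) ↔ content R f ≤ I :=
  ⟨content_le_of_mem_map, fun h => Ideal.map_mono h (hS f)⟩

/-- Extension of ideals along a flat algebra commutes with taking the colon by an element. -/
lemma mem_map_colon_of_mul_mem_map [Module.Flat R S] {N : Ideal R} {x : R} {s : S}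
    (h : algebraMap R S x * s ∈ N.map (algebraMap R S)) :
    s ∈ (N.colon {x}).map (algebraMap R S) := by
  obtain ⟨ι, _, n, t, hn, ht⟩ : ∃ (ι : Type) (_ : Fintype ι) (n : ι → R) (t : ι → S),
      (∀ i, n i ∈ N) ∧ algebraMap R S x * s = ∑ i, n i • t i := by
    generalize algebraMap R S x * s = y at h
    induction h using Submodule.span_induction with
    | mem y hy =>
      obtain ⟨a, ha, rfl⟩ := hy
      exact ⟨Unit, inferInstance, fun _ => a, fun _ => 1, fun _ => ha,
        by simp [Algebra.smul_def]⟩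
    | zero => exact ⟨Empty, inferInstance, Empty.elim, Empty.elim, fun i => i.elim, by simp⟩
    | add y z _ _ hy hz =>
      obtain ⟨ι, _, n, t, hn, rfl⟩ := hy
      obtain ⟨κ, _, m, u, hm, rfl⟩ := hz
      exact ⟨ι ⊕ κ, inferInstance, Sum.elim n m, Sum.elim t u,
        fun i => by cases i <;> simp [hn, hm], by simp⟩
    | smul c y _ hy =>
      obtain ⟨ι, _, n, t, hn, rfl⟩ := hy
      exact ⟨ι, inferInstance, n, fun i => c * t i, hn, by
        simp [Finset.mul_sum]⟩
  -- Equational criterion for `x(-s) + ∑ nᵢtᵢ = 0`, with `none` indexing the `x` term: the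
  -- coefficients expressing `-s` lie in `N : x`.
  obtain ⟨k, a, y, hay, ha⟩ := Module.Flat.isTrivialRelation_of_sum_smul_eq_zero (R := R) (M := S)
    (f := fun o : Option ι => o.elim x n) (x := fun o : Option ι => o.elim (-s) t) (by
      simp [Fintype.sum_option, ← ht, ← Algebra.smul_def])
  have hs : -s = ∑ j, a none j • y j := hay none
  rw [← neg_mem_iff, hs]
  refine Ideal.sum_mem _ fun j _ => ?_
  rw [Algebra.smul_def]
  refine Ideal.mul_mem_right _ _ (Ideal.mem_map_of_mem _ ?_)
  have hj := ha j
  simp only [Fintype.sum_option, Option.elim_none, Option.elim_some] at hj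
  rw [Submodule.mem_colon_singleton, smul_eq_mul, mul_comm, eq_neg_of_add_eq_zero_left hj]
  exact N.neg_mem (Ideal.sum_mem _ fun i _ => N.mul_mem_right _ (hn i))

/-- If `f` kills a nonzero element of `S/IS`, then it kills the class of some `h` whose
annihilator in `R` is prime. -/
lemma exists_isPrime_comap_colon [IsNoetherianRing R] {I : Ideal R} {f g : S}
    (hfg : f * g ∈ I.map (algebraMap R S)) (hg : g ∉ I.map (algebraMap R S)) :
    ∃ h : S, f * h ∈ I.map (algebraMap R S) ∧ h ∉ I.map (algebraMap R S) ∧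
      (((I.map (algebraMap R S)).colon {h}).comap (algebraMap R S)).IsPrime := by
  obtain ⟨_, ⟨h, ⟨hfh, hh⟩, rfl⟩, hmax⟩ := set_has_maximal_iff_noetherian.mpr
    (inferInstance : IsNoetherian R R)
    ((fun h : S => ((I.map (algebraMap R S)).colon {h}).comap (algebraMap R S)) ''
      {h | f * h ∈ I.map (algebraMap R S) ∧ h ∉ I.map (algebraMap R S)}) ⟨_, g, ⟨hfg, hg⟩, rfl⟩
  refine ⟨h, hfh, hh, ?_, ?_⟩
  · rw [Ne, Ideal.eq_top_iff_one]
    simpa [Submodule.mem_colon_singleton] using hh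
  · intro a b hab
    by_contra! hcon
    simp only [Ideal.mem_comap, Submodule.mem_colon_singleton, smul_eq_mul] at hab hcon
    -- Passing from `h` to `bh` would strictly enlarge a maximal annihilator, since it gains `a`.
    refine hmax _ ⟨algebraMap R S b * h, ⟨?_, hcon.2⟩, rfl⟩ (SetLike.lt_iff_le_and_exists.mpr
      ⟨fun r hr => ?_, a, ?_, ?_⟩)
    · rw [mul_left_comm]
      exact Ideal.mul_mem_left _ _ hfh
    · simp only [Ideal.mem_comap, Submodule.mem_colon_singleton, smul_eq_mul] at hr ⊢
      rw [mul_left_comm]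
      exact Ideal.mul_mem_left _ _ hr
    · simpa [Ideal.mem_comap, Submodule.mem_colon_singleton, mul_assoc] using hab
    · simpa [Ideal.mem_comap, Submodule.mem_colon_singleton] using hcon.1

/-- A residual form of the McCoy property for a flat Ohm-Rush algebra over a Noetherian ring in
which primes extend to primes. -/
lemma IsOhmRush.exists_forall_mul_mem [IsNoetherianRing R] [Module.Flat R S]
    (hS : IsOhmRush R S)
    (hprime : ∀ p : Ideal R, p.IsPrime → (p.map (algebraMap R S)).IsPrime)
    {I : Ideal R} {f g : S} (hfg : f * g ∈ I.map (algebraMap R S))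
    (hg : g ∉ I.map (algebraMap R S)) :
    ∃ r ∉ I, ∀ a ∈ content R f, r * a ∈ I := by
  obtain ⟨h, hfh, hh, hp⟩ := exists_isPrime_comap_colon hfg hg
  set p := ((I.map (algebraMap R S)).colon {h}).comap (algebraMap R S) with hpdef
  have mem_p (r : R) : r ∈ p ↔ algebraMap R S r * h ∈ I.map (algebraMap R S) := by
    simp [hpdef, Submodule.mem_colon_singleton]
  have hpc (t : R) (ht : t ∈ p) (x : R) (hx : x ∈ content R h) : t * x ∈ I := by
    have := content_le_of_mem_map (mem_map_colon_of_mul_mem_map ((mem_p t).mp ht)) hx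
    rwa [Submodule.mem_colon_singleton, smul_eq_mul, mul_comm] at this
  -- `N` is maximal such that `h` stays nonzero in `S/NS` localized at `p`. Adjoining any `x ∈ c(h)
  -- \ N` kills it there, so `wh = sx + n` with `w ∉ p`; this `s` takes over the role of `h`, now
  -- modulo `pS`.
  obtain ⟨N, ⟨hIN, hN⟩, hmax⟩ : ∃ N : Ideal R,
      N ∈ {N | I ≤ N ∧ ∀ w ∉ p, algebraMap R S w * h ∉ N.map (algebraMap R S)} ∧
      ∀ N' ∈ {N | I ≤ N ∧ ∀ w ∉ p, algebraMap R S w * h ∉ N.map (algebraMap R S)}, ¬N < N' :=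
    set_has_maximal_iff_noetherian.mpr (inferInstance : IsNoetherian R R) _
      ⟨I, le_rfl, fun w hw hwh => hw ((mem_p w).mpr hwh)⟩
  have hhN : h ∉ N.map (algebraMap R S) := by
    simpa using hN 1 ((Ideal.ne_top_iff_one p).mp hp.ne_top)
  obtain ⟨x, hx, hxN⟩ := SetLike.not_le_iff_exists.mp (mt hS.mem_map_iff.mpr hhN)
  obtain ⟨w, hw, hwh⟩ : ∃ w ∉ p,
      algebraMap R S w * h ∈ (Ideal.span {x} ⊔ N).map (algebraMap R S) := by
    by_contra! hcon
    refine hmax (Ideal.span {x} ⊔ N) ⟨hIN.trans le_sup_right, hcon⟩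
      (SetLike.lt_iff_le_and_exists.mpr ⟨le_sup_right, x, ?_, hxN⟩)
    exact Ideal.mem_sup_left (Ideal.mem_span_singleton_self x)
  have hcolon : N.colon {x} ≤ p := by
    intro u hu
    rw [Submodule.mem_colon_singleton, smul_eq_mul] at hu
    by_contra hup
    refine hN (u * w) (fun hmem => (hp.mem_or_mem hmem).elim hup hw) ?_
    have hle : (Ideal.span {u} * (Ideal.span {x} ⊔ N)) ≤ N := by
      rw [Ideal.mul_sup, Ideal.span_singleton_mul_span_singleton, sup_le_iff,
        Ideal.span_singleton_le_iff_mem]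
      exact ⟨hu, Ideal.mul_le_right⟩
    refine Ideal.map_mono hle ?_
    rw [Ideal.map_mul, map_mul, mul_assoc]
    exact Ideal.mul_mem_mul (Ideal.mem_map_of_mem _ (Ideal.mem_span_singleton_self u)) hwh
  rw [Ideal.map_sup, Ideal.map_span, Set.image_singleton, Ideal.mem_span_singleton_sup] at hwh
  obtain ⟨s, n, hn, hsn⟩ := hwh
  have hfs : f * s ∈ p.map (algebraMap R S) := by
    refine Ideal.map_mono hcolon (mem_map_colon_of_mul_mem_map ?_)
    have : algebraMap R S x * (f * s) = algebraMap R S w * (f * h) - f * n := by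
      linear_combination f * hsn
    rw [this]
    exact Ideal.sub_mem _ (Ideal.mul_mem_left _ _ (Ideal.map_mono hIN hfh))
      (Ideal.mul_mem_left _ _ hn)
  -- Since `px ≤ I ≤ N`, having `s ∈ pS` would put `wh` in `NS`.
  have hs : s ∉ p.map (algebraMap R S) := by
    intro hs
    refine hN w hw (hsn ▸ Ideal.add_mem _ ?_ hn)
    have hle : p * Ideal.span {x} ≤ N := by
      rw [Ideal.mul_le]
      intro t ht y hy
      obtain ⟨c, rfl⟩ := Ideal.mem_span_singleton.mp hy
      rw [← mul_assoc]
      exact N.mul_mem_right _ (hIN (hpc t ht x hx))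
    refine Ideal.map_mono hle ?_
    rw [Ideal.map_mul]
    exact Ideal.mul_mem_mul hs (Ideal.mem_map_of_mem _ (Ideal.mem_span_singleton_self x))
  have hf : content R f ≤ p :=
    content_le_of_mem_map (((hprime p hp).mem_or_mem hfs).resolve_right hs)
  exact ⟨x, fun hxI => hxN (hIN hxI), fun a ha => mul_comm a x ▸ hpc a (hf ha) x hx⟩

/-! ### Content modulo an ideal -/

lemma mk_mem_map_map_iff {I J : Ideal R} {f : S} :
    Ideal.Quotient.mk (I.map (algebraMap R S)) f ∈
      (J.map (Ideal.Quotient.mk I)).map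
        (algebraMap (R ⧸ I) (S ⧸ I.map (algebraMap R S))) ↔
      f ∈ (J ⊔ I).map (algebraMap R S) := by
  have hcomp : (algebraMap (R ⧸ I) (S ⧸ I.map (algebraMap R S))).comp (Ideal.Quotient.mk I) =
      (Ideal.Quotient.mk (I.map (algebraMap R S))).comp (algebraMap R S) := rfl
  rw [Ideal.map_map, hcomp, ← Ideal.map_map, Ideal.mem_quotient_iff_mem_sup, Ideal.map_sup]

lemma IsOhmRush.content_mk (hS : IsOhmRush R S) (I : Ideal R) (f : S) :
    content (R ⧸ I) (Ideal.Quotient.mk (I.map (algebraMap R S)) f) =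
      (content R f).map (Ideal.Quotient.mk I) := by
  refine le_antisymm (content_le_of_mem_map ?_) (le_sInf fun J hJ => ?_)
  · exact mk_mem_map_map_iff.mpr (Ideal.map_mono le_sup_left (hS f))
  · obtain ⟨K, rfl⟩ : ∃ K : Ideal R, K.map (Ideal.Quotient.mk I) = J :=
      ⟨_, Ideal.map_comap_of_surjective _ Ideal.Quotient.mk_surjective J⟩
    refine (Ideal.map_mono (content_le_of_mem_map (mk_mem_map_map_iff.mp hJ))).trans ?_
    simp [Ideal.map_sup]

lemma IsOhmRush.quotient (hS : IsOhmRush R S) (I : Ideal R) :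
    IsOhmRush (R ⧸ I) (S ⧸ I.map (algebraMap R S)) := by
  intro f
  obtain ⟨f, rfl⟩ := Ideal.Quotient.mk_surjective f
  rw [hS.content_mk]
  exact mk_mem_map_map_iff.mpr (Ideal.map_mono le_sup_left (hS f))

lemma IsOhmRush.isMcCoy_quotient [IsNoetherianRing R] [Module.Flat R S] (hS : IsOhmRush R S)
    (hprime : ∀ p : Ideal R, p.IsPrime → (p.map (algebraMap R S)).IsPrime) (I : Ideal R) :
    IsMcCoy (R ⧸ I) (S ⧸ I.map (algebraMap R S)) := by
  refine ⟨hS.quotient I, fun f g hfg hg => ?_⟩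
  obtain ⟨f, rfl⟩ := Ideal.Quotient.mk_surjective f
  obtain ⟨g, rfl⟩ := Ideal.Quotient.mk_surjective g
  rw [← map_mul, Ideal.Quotient.eq_zero_iff_mem] at hfg
  rw [Ne, Ideal.Quotient.eq_zero_iff_mem] at hg
  obtain ⟨r, hr, hrf⟩ := hS.exists_forall_mul_mem hprime hfg hg
  refine ⟨Ideal.Quotient.mk I r, mt Ideal.Quotient.eq_zero_iff_mem.mp hr, fun a ha => ?_⟩
  rw [hS.content_mk] at ha
  obtain ⟨b, hb, rfl⟩ :=
    (Ideal.mem_map_iff_of_surjective _ Ideal.Quotient.mk_surjective).mp ha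
  rw [← map_mul, Ideal.Quotient.eq_zero_iff_mem]
  exact hrf b hb

/-! ### Comparison with primes extending to primes -/

lemma map_ne_top_of_isPrime [Module.FaithfullyFlat R S] {p : Ideal R} (hp : p.IsPrime) :
    p.map (algebraMap R S) ≠ ⊤ := by
  intro h
  apply hp.ne_top
  rw [← Ideal.comap_map_eq_self_of_faithfullyFlat (B := S) p, h, Ideal.comap_top]

/-- `R/p` is a domain, so a nonzero element killing the content of `f` modulo `p` forces `c(f) ≤ p`.
-/
lemma IsOhmRush.isPrime_map_of_isMcCoy [Module.FaithfullyFlat R S] (hS : IsOhmRush R S)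
    {p : Ideal R} (hp : p.IsPrime) (h : IsMcCoy (R ⧸ p) (S ⧸ p.map (algebraMap R S))) :
    (p.map (algebraMap R S)).IsPrime := by
  refine ⟨map_ne_top_of_isPrime hp, fun {f g} hfg => or_iff_not_imp_right.mpr fun hg => ?_⟩
  obtain ⟨r, hr, hrf⟩ := h.exists_mul_content_eq_zero (Ideal.Quotient.mk _ f)
    (Ideal.Quotient.mk _ g) (by rwa [← map_mul, Ideal.Quotient.eq_zero_iff_mem])
    (mt Ideal.Quotient.eq_zero_iff_mem.mp hg)
  refine hS.mem_map_iff.mpr fun a ha => Ideal.Quotient.eq_zero_iff_mem.mp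
    ((mul_eq_zero.mp (hrf (Ideal.Quotient.mk p a) ?_)).resolve_left hr)
  rw [hS.content_mk]
  exact Ideal.mem_map_of_mem _ ha

lemma IsWeakContent.isPrime_map [Module.FaithfullyFlat R S] (h : IsWeakContent R S)
    {p : Ideal R} (hp : p.IsPrime) : (p.map (algebraMap R S)).IsPrime := by
  refine ⟨map_ne_top_of_isPrime hp, fun {f g} hfg => ?_⟩
  rw [h.isOhmRush.mem_map_iff, h.isOhmRush.mem_map_iff, ← hp.mul_le, ← hp.radical_le_iff,
    ← h.radical_eq, hp.radical_le_iff]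
  exact content_le_of_mem_map hfg

/-- The two radicals are intersections over the same primes: `p` contains `c(fg)` iff it contains
`c(f)` or `c(g)`. -/
lemma IsOhmRush.isWeakContent (hS : IsOhmRush R S)
    (hprime : ∀ p : Ideal R, p.IsPrime → (p.map (algebraMap R S)).IsPrime) :
    IsWeakContent R S := by
  refine ⟨hS, fun f g => ?_⟩
  rw [Ideal.radical_eq_sInf, Ideal.radical_eq_sInf]
  congr 1
  ext p
  refine and_congr_left fun hp => ?_
  rw [hp.mul_le, ← hS.mem_map_iff, ← hS.mem_map_iff, ← hS.mem_map_iff]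
  exact (hprime p hp).mul_mem_iff_mem_or_mem

lemma IsSemicontent.isPrime_map (h : IsSemicontent R S) {p : Ideal R} (hp : p.IsPrime) :
    (p.map (algebraMap R S)).IsPrime := by
  have := h.faithfullyFlat
  refine ⟨map_ne_top_of_isPrime hp, fun {f g} hfg => or_iff_not_imp_left.mpr fun hf => ?_⟩
  obtain ⟨w, hwf, hwp⟩ := SetLike.not_le_iff_exists.mp (mt h.isOhmRush.mem_map_iff.mpr hf)
  rw [h.isOhmRush.mem_map_iff]
  -- With `W = R \ p`, the semicontent equality puts `c(g)` inside `p` after localizing at `p`.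
  have hmap := h.map_content_eq p.primeCompl f g ⟨w, hwp, hwf⟩
  calc content R g
      ≤ ((content R g).map (algebraMap R (Localization p.primeCompl))).comap
          (algebraMap R (Localization p.primeCompl)) := Ideal.le_comap_map
    _ ≤ (p.map (algebraMap R (Localization p.primeCompl))).comap
          (algebraMap R (Localization p.primeCompl)) := by
        rw [← hmap]
        exact Ideal.comap_mono (Ideal.map_mono (content_le_of_mem_map hfg))
    _ = p := IsLocalization.under_map_of_isPrime_disjoint p.primeCompl _ hp
        (Set.disjoint_left.mpr fun x hx hxp => hx hxp)

lemma IsOhmRush.isSemicontent [IsNoetherianRing R] [Module.FaithfullyFlat R S]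
    (hS : IsOhmRush R S)
    (hprime : ∀ p : Ideal R, p.IsPrime → (p.map (algebraMap R S)).IsPrime) :
    IsSemicontent R S := by
  refine ⟨inferInstance, hS, fun W f g ⟨w, hwW, hwf⟩ => le_antisymm ?_ ?_⟩
  · exact Ideal.map_mono (content_le_of_mem_map (Ideal.mul_mem_left _ f (hS g)))
  · rw [Ideal.map_le_iff_le_comap]
    -- `I` is saturated with respect to `W`: if `g ∉ IS`, the `r ∉ I` obtained has `rw ∈ I`, yet `w`
    -- is a unit in `R_W`.
    set I := ((content R (f * g)).map (algebraMap R (Localization W))).comap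
      (algebraMap R (Localization W))
    apply content_le_of_mem_map
    by_contra hg
    obtain ⟨r, hr, hrf⟩ := hS.exists_forall_mul_mem hprime
      (Ideal.map_mono Ideal.le_comap_map (hS (f * g))) hg
    apply hr
    have hrw := hrf w hwf
    rw [Ideal.mem_comap, map_mul, Ideal.mul_unit_mem_iff_mem _
      (IsLocalization.map_units (Localization W) ⟨w, hwW⟩)] at hrw
    exact hrw

end

end OhmRush

theorem mainTheorem3 {R S : Type*} [CommRing R] [CommRing S] [Algebra R S]
    [IsNoetherianRing R] [Module.FaithfullyFlat R S] (hS : OhmRush.IsOhmRush R S) :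
    List.TFAE [
      OhmRush.IsWeakContent R S,
      OhmRush.IsSemicontent R S,
      OhmRush.IsResiduallyMcCoy R S,
      OhmRush.IsResiduallyMcCoyFor R S {I : Ideal R | I.IsRadical},
      OhmRush.IsResiduallyMcCoyFor R S {I : Ideal R | I.IsPrime}] := by
  have hweak : OhmRush.IsWeakContent R S ↔
      ∀ p : Ideal R, p.IsPrime → (p.map (algebraMap R S)).IsPrime :=
    ⟨fun h _ hp => h.isPrime_map hp, hS.isWeakContent⟩
  tfae_have 1 → 2 := fun h => hS.isSemicontent (hweak.mp h)
  tfae_have 2 → 1 := fun h => hweak.mpr fun _ hp => h.isPrime_map hp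
  tfae_have 1 → 3 := fun h => ⟨hS, fun I _ => hS.isMcCoy_quotient (hweak.mp h) I⟩
  tfae_have 3 → 4 := fun h => ⟨hS, fun I _ => h.isMcCoy_quotient I trivial⟩
  tfae_have 4 → 5 := fun h => ⟨hS, fun I hI => h.isMcCoy_quotient I hI.isRadical⟩
  tfae_have 5 → 1 := fun h => hweak.mpr fun p hp =>
    hS.isPrime_map_of_isMcCoy hp (h.isMcCoy_quotient p hp)
  tfae_finish
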